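/- Let $\alpha\in(0,1)$ be irrational with continued fraction expansion $\alpha=[0;d_0+1,d_1,d_2,\ldots]$ (so $d_0\ge 0$ and $d_n\ge 1$ for $n\ge 1$), and let $w$ be the standard Sturmian word of slope $\alpha$, that is, the infinite word over $\{a,b\}$ which is the limit of the finite words $s_{-1}=b$, $s_0=a$, $s_{n+1}=s_n^{d_n}s_{n-1}$ ($n\ge 0$). Call a finite word $v$ closed if it is empty or has a factor $u\ne v$ that occurs in $v$ exactly twice, as a prefix and as a suffix (with no internal occurrence), and open otherwise; let $\mathrm{oc}(w)=c(1)c(2)\cdots$ be the binary sequence with $c(n)=1$ if the prefix of $w$ of length $n$ is closed and $c(n)=0$ if it is open. Let $K$ denote the continuants: $K[\;]=1$, $K[a_0]=a_0$, and $K[a_0,\ldots,a_m]=a_mK[a_0,\ldots,a_{m-1}]+K[a_0,\ldots,a_{m-2}]$ for $m\ge 1$. For every $n\ge 0$ put $$k_n=K[1,d_0,\ldots,d_{n-1},d_n-1].$$ Then every $k_n$ is a nonnegative integer, $k_n>0$ for $n\ge1$, $k_0>0$ if $d_0>0$ (that is, if $w$ starts with $a$), and $$\mathrm{oc}(w)=\prod_{n\ge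 0}1^{k_n}0^{k_n}.$$ In particular, every (maximal) run of closed nonempty prefixes of $w$ is followed by an equally long run of open prefixes. -/

import Mathlib

namespace OCSeq

/-- The binary alphabet `{a, b}`. -/
inductive Letter
  | a
  | b

/-- An infinite word `w[1] w[2] ⋯` over `A` is a function `w : ℕ → A`, where `w i` is the letter
`w[i + 1]`. This is its prefix of length `n`. -/
def wordPrefix {A : Type*} (w : ℕ → A) (n : ℕ) : List A :=
  List.ofFn (fun i : Fin n => w i)

/-- A sequence of finite words converges to the infinite word `w`: every letter of `w` is
eventually the letter at the same position of the finite words. -/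
def ConvergesTo {A : Type*} (s : ℕ → List A) (w : ℕ → A) : Prop :=
  ∀ i, ∀ᶠ n in Filter.atTop, (s n)[i]? = some (w i)

/-- `w = ∏_{n ≥ 0} u n`: the finite products `u 0 ⋯ u (N - 1)` converge to `w`. -/
def IsInfiniteProduct {A : Type*} (u : ℕ → List A) (w : ℕ → A) : Prop :=
  ConvergesTo (fun N => ((List.range N).map u).flatten) w

/-- A finite word is closed if it is empty or has a factor `v ≠ w` that occurs in `w` exactly
twice, as a prefix and as a suffix, with no internal occurrences. -/
def IsClosedWord {A : Type*} (w : List A) : Prop :=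
  w = [] ∨ ∃ v : List A, v ≠ w ∧ v <+: w ∧ v <:+ w ∧
    ∀ p q : List A, w = p ++ v ++ q → p = [] ∨ q = []

open Classical in
/-- The oc-sequence of an infinite word, itself an infinite word over `{0, 1}`: its letter number
`i + 1` is `1` if the prefix of length `i + 1` is closed and `0` if it is open. -/
noncomputable def oc {A : Type*} (w : ℕ → A) : ℕ → Fin 2 :=
  fun i => if IsClosedWord (wordPrefix w (i + 1)) then 1 else 0

/-- `α` has the regular continued fraction expansion `[0; d 0 + 1, d 1, d 2, …]`. -/
def HasExpansion (α : ℝ) (d : ℕ → ℕ) : Prop :=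
  (GenContFract.of α).h = 0 ∧
  (GenContFract.of α).partDens.get? 0 = some ((d 0 : ℝ) + 1) ∧
  ∀ n, 1 ≤ n → (GenContFract.of α).partDens.get? n = some (d n : ℝ)

/-- The standard sequence, with the index shifted by one: `standardSeq d (n + 1)` is `s_n`, where
`s_{-1} = b`, `s_0 = a`, `s_{n+1} = s_n ^ (d n) s_{n-1}`. -/
def standardSeq (d : ℕ → ℕ) : ℕ → List Letter
  | 0 => [Letter.b]
  | 1 => [Letter.a]
  | n + 2 => (List.replicate (d n) (standardSeq d (n + 1))).flatten ++ standardSeq d n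

/-- `w` is the standard Sturmian word of slope `α`. -/
def IsStandardSturmianOfSlope (w : ℕ → Letter) (α : ℝ) : Prop :=
  Irrational α ∧ 0 < α ∧ α < 1 ∧
    ∃ d : ℕ → ℕ, HasExpansion α d ∧ ConvergesTo (standardSeq d) w

/-- `continuantSeq a m` is the continuant `K[a 0, …, a (m - 1)]` of the first `m` terms. -/
def continuantSeq (a : ℕ → ℤ) : ℕ → ℤ
  | 0 => 1
  | 1 => a 0
  | m + 2 => a (m + 1) * continuantSeq a (m + 1) + continuantSeq a m

/-- The continuant `K[a_0, …, a_{m-1}]` of a finite list of integers. -/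
def continuant (l : List ℤ) : ℤ :=
  continuantSeq (fun i => l.getD i 0) l.length

end OCSeq

namespace OCSeq

/-! Write q_n = |s_n|, the length of `standardSeq d (n + 1)`. The products s_n s_{n+1} and s_{n+1}
s_n differ only by a swap of their last two letters. Hence, if d_n ≥ 1, q_n is a period of the
prefix of w of length q_{n+1} + q_n - 2 and of no longer one.

A prefix of length L is closed when it has a period p whose border, of length L - p, has no internal
occurrence. Fine–Wilf and the primitivity of s_n show that it is closed for 2q_n - 2 < L ≤ q_{n+1} +
q_n - 2 (`isClosedWord_of_le`) and open for q_{n+1} + q_n - 2 < L ≤ 2q_{n+1} - 2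
(`not_isClosedWord_of_le`). Both ranges have q_{n+1} - q_n = k_n elements, and together they tile
the positive integers. -/

/-- `p` is a period of the prefix of length `N` of `f`. -/
def HasPrefixPeriod {A : Type*} (f : ℕ → A) (p N : ℕ) : Prop :=
  ∀ i, i + p < N → f i = f (i + p)

/-! ### Periods of prefixes and Fine–Wilf -/

namespace HasPrefixPeriod

variable {A : Type*} {f : ℕ → A} {p q M N : ℕ}

theorem mono (h : HasPrefixPeriod f p N) (hMN : M ≤ N) : HasPrefixPeriod f p M :=
  fun i hi => h i (hi.trans_le hMN)

theorem apply_add_mul (h : HasPrefixPeriod f p N) (i k : ℕ) (hi : i + k * p < N) :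
    f i = f (i + k * p) := by
  induction k with
  | zero => simp
  | succ k ih =>
    have e : i + (k + 1) * p = i + k * p + p := by ring
    rw [e] at hi ⊢
    rw [ih (by omega), h _ hi]

theorem of_dvd (h : HasPrefixPeriod f p N) (hpq : p ∣ q) : HasPrefixPeriod f q N := by
  obtain ⟨k, rfl⟩ := hpq
  intro i hi
  rw [mul_comm] at hi ⊢
  exact h.apply_add_mul i k hi

/-- A period that divides a larger period of the whole prefix may be checked on an initial part
that covers the larger period. -/
theorem extend {g : ℕ} (hg : HasPrefixPeriod f g M) (hp : HasPrefixPeriod f p N)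
    (hgp : g ∣ p) (hg0 : 0 < g) (hp0 : 0 < p) (hpM : p ≤ M) : HasPrefixPeriod f g N := by
  have hle : g ≤ p := Nat.le_of_dvd hp0 hgp
  intro i
  induction i using Nat.strong_induction_on with
  | _ i ih =>
    intro hi
    rcases lt_or_ge i p with h | h
    · rcases lt_or_ge (i + g) p with h' | h'
      · exact hg i (by omega)
      -- Wrap around modulo p: the position i + g - p lies p - g before i, and g divides p - g.
      · have e1 : f (i + g) = f (i + g - p) := by
          have := hp (i + g - p) (by omega)
          rw [this]
          congr 1
          omega
        have e2 : f (i + g - p) = f i := by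
          have := hg.of_dvd (Nat.dvd_sub hgp dvd_rfl) (i + g - p) (by omega)
          rw [this]
          congr 1
          omega
        rw [e1, e2]
    · have e1 : f (i - p) = f i := by
        have := hp (i - p) (by omega)
        rwa [Nat.sub_add_cancel h] at this
      have e2 : f (i - p + g) = f (i + g) := by
        have := hp (i - p + g) (by omega)
        rw [this]
        congr 1
        omega
      rw [← e1, ← e2]
      exact ih (i - p) (by omega) (by omega)

theorem hasPeriod_wordPrefix_iff :
    (wordPrefix f N).HasPeriod p ↔ HasPrefixPeriod f p N := by
  rw [List.hasPeriod_iff_getElem?]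
  have hget : ∀ i, i < N → (wordPrefix f N)[i]? = some (f i) := fun i hi => by
    simp [wordPrefix, hi]
  simp only [wordPrefix, List.length_ofFn] at hget ⊢
  refine forall_congr' fun i => ⟨fun h hi => ?_, fun h hi => ?_⟩
  · have := h (by omega)
    rwa [hget _ (by omega), hget _ hi, Option.some_inj] at this
  · rw [hget _ (by omega), hget _ (by omega), h (by omega)]

/-- The theorem of Fine and Wilf for prefixes of an infinite word. -/
theorem gcd (hp : HasPrefixPeriod f p N) (hq : HasPrefixPeriod f q N)
    (hN : p + q ≤ N + p.gcd q) : HasPrefixPeriod f (p.gcd q) N := by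
  rw [← hasPeriod_wordPrefix_iff] at hp hq ⊢
  exact hp.gcd hq (by simp only [wordPrefix, List.length_ofFn]; omega)

theorem count_mul (P : A → Prop) [DecidablePred P] {g : ℕ} (k : ℕ)
    (h : HasPrefixPeriod f g (k * g)) :
    Nat.count (fun i => P (f i)) (k * g) = k * Nat.count (fun i => P (f i)) g := by
  induction k with
  | zero => simp
  | succ k ih =>
    have e : (k + 1) * g = k * g + g := by ring
    rw [e, Nat.count_add, ih (h.mono (by rw [e]; omega))]
    have : Nat.count (fun i => P (f (k * g + i))) g = Nat.count (fun i => P (f i)) g := by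
      simp only [Nat.count_eq_card_filter_range]
      congr 1
      apply Finset.filter_congr
      intro i hi
      rw [Finset.mem_range] at hi
      rw [h.apply_add_mul i k (by rw [e]; omega), add_comm]
    rw [this]
    ring

end HasPrefixPeriod

/-! ### Closed prefixes in terms of periods -/

/-- The periodicity criterion for closed prefixes. -/
theorem isClosedWord_wordPrefix_iff {A : Type*} (w : ℕ → A) {L : ℕ} (hL : 0 < L) :
    IsClosedWord (wordPrefix w L) ↔ ∃ p, 0 < p ∧ p ≤ L ∧ HasPrefixPeriod w p L ∧
      ∀ i, 0 < i → i < p → ∃ j, j + p < L ∧ w (i + j) ≠ w j := by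
  have hlen : ∀ n, (wordPrefix w n).length = n := fun n => by simp [wordPrefix]
  have hget : ∀ n i, i < n → (wordPrefix w n)[i]? = some (w i) := fun n i hi => by
    simp [wordPrefix, hi]
  constructor
  · rintro (h | ⟨v, hne, hpre, ⟨u, hu⟩, hint⟩)
    · have := hlen L
      rw [h] at this
      simp at this
      omega
    · have hul : u.length + v.length = L := by
        rw [← hlen L, ← hu, List.length_append]
      have hv : ∀ j, j < v.length → v[j]? = some (w j) := fun j hj => by
        obtain ⟨t, ht⟩ := hpre
        rw [← hget L j (by omega), ← ht, List.getElem?_append_left hj]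
      have hv' : ∀ j, j < v.length → v[j]? = some (w (u.length + j)) := fun j hj => by
        rw [← hget L (u.length + j) (by omega), ← hu,
          List.getElem?_append_right (by omega)]
        congr 1
        omega
      have hu0 : 0 < u.length := by
        rcases Nat.eq_zero_or_pos u.length with h | h
        · rw [List.length_eq_zero_iff] at h
          subst h
          exact absurd hu hne
        · exact h
      refine ⟨u.length, hu0, by omega, ?_, ?_⟩
      · intro i hi
        have := (hv i (by omega)).symm.trans (hv' i (by omega))
        rw [Option.some_inj] at this
        rw [this, add_comm]
      · intro i hi0 hip
        by_contra! hcon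
        -- A border match at a shift 0 < i < |u| is an internal occurrence.
        have hsplit : wordPrefix w L = (wordPrefix w L).take i ++ v ++
            (wordPrefix w L).drop (i + v.length) := by
          apply List.ext_getElem?
          intro j
          rcases lt_or_ge j i with h1 | h1
          · rw [List.append_assoc, List.getElem?_append_left (by simp [hlen]; omega),
              List.getElem?_take_of_lt h1]
          · have hti : ((wordPrefix w L).take i).length = i := by simp [hlen]; omega
            rcases lt_or_ge j (i + v.length) with h2 | h2
            · rw [List.getElem?_append_left (by simp [hlen]; omega),
                List.getElem?_append_right (by omega), hti, hv _ (by omega),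
                hget _ _ (by omega), ← hcon (j - i) (by omega)]
              congr 2
              omega
            · rw [List.getElem?_append_right (by simp [hlen]; omega), List.getElem?_drop]
              congr 1
              simp only [List.length_append, hti]
              omega
        rcases hint _ _ hsplit with h | h
        · have := congrArg List.length h
          simp [hlen] at this
          omega
        · have := congrArg List.length h
          simp [hlen] at this
          omega
  · rintro ⟨p, hp0, hpL, hper, hint⟩
    have hsub : ∀ i n, i + n = L → (wordPrefix w L).drop i =
        List.ofFn (fun j : Fin n => w (i + j)) := fun i n hin => by
      apply List.ext_getElem?
      intro j
      rcases lt_or_ge j n with h | h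
      · rw [List.getElem?_drop, hget _ _ (by omega)]
        simp [h]
      · rw [List.getElem?_eq_none (by simp [hlen]; omega), List.getElem?_eq_none (by simp; omega)]
    refine Or.inr ⟨wordPrefix w (L - p), ?_, ?_, ?_, ?_⟩
    · intro h
      have := congrArg List.length h
      rw [hlen, hlen] at this
      omega
    · rw [List.prefix_iff_getElem?]
      intro i hi
      rw [hlen] at hi
      rw [hget _ _ (by omega), ← hget _ _ hi, List.getElem?_eq_getElem]
    · refine ⟨(wordPrefix w L).take p, ?_⟩
      have : wordPrefix w (L - p) = (wordPrefix w L).drop p := by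
        rw [hsub p (L - p) (by omega)]
        unfold wordPrefix
        congr 1
        funext i
        have := i.2
        rw [hper i (by omega), add_comm]
      rw [this, List.take_append_drop]
    · intro s t hst
      by_contra! hcon
      have hl := congrArg List.length hst
      simp only [List.length_append, hlen] at hl
      have hs := List.length_pos_iff.2 hcon.1
      have ht := List.length_pos_iff.2 hcon.2
      obtain ⟨j, hj, hne⟩ := hint s.length hs (by omega)
      apply hne
      have e := hget L (s.length + j) (by omega)
      rw [hst, List.append_assoc, List.getElem?_append_right (by omega),
        List.getElem?_append_left (by rw [hlen]; omega), hget _ _ (by omega)] at e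
      have := Option.some_inj.1 e
      rw [← this]
      congr 1
      omega

theorem wordPrefix_succ {A : Type*} (w : ℕ → A) (n : ℕ) :
    wordPrefix w (n + 1) = wordPrefix w n ++ [w n] := by
  unfold wordPrefix
  rw [List.ofFn_succ_last]
  simp

theorem countP_wordPrefix {A : Type*} (w : ℕ → A) (P : A → Bool) (n : ℕ) :
    (wordPrefix w n).countP P = Nat.count (fun i => P (w i) = true) n := by
  induction n with
  | zero => simp [wordPrefix]
  | succ n ih =>
    rw [wordPrefix_succ, List.countP_append, ih, Nat.count_succ, List.countP_singleton]

theorem eq_wordPrefix {A : Type*} {w : ℕ → A} {l : List A}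
    (h : ∀ i, i < l.length → l[i]? = some (w i)) : l = wordPrefix w l.length := by
  apply List.ext_getElem?
  intro i
  rcases lt_or_ge i l.length with hi | hi
  · rw [h i hi]
    simp [wordPrefix, hi]
  · rw [List.getElem?_eq_none hi, List.getElem?_eq_none (by simpa [wordPrefix] using hi)]

/-- Recognizes the letter `a`. -/
def Letter.isA : Letter → Bool
  | .a => true
  | .b => false

/-! ### Standard words: primitivity and near-commutation -/

section StandardSeq

variable {d : ℕ → ℕ}

theorem standardSeq_add_two (d : ℕ → ℕ) (n : ℕ) : standardSeq d (n + 2) =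
    (List.replicate (d n) (standardSeq d (n + 1))).flatten ++ standardSeq d n := rfl

theorem length_standardSeq_add_two (d : ℕ → ℕ) (n : ℕ) : (standardSeq d (n + 2)).length =
    d n * (standardSeq d (n + 1)).length + (standardSeq d n).length := by
  simp [standardSeq_add_two]

theorem countP_standardSeq_add_two (P : Letter → Bool) (d : ℕ → ℕ) (n : ℕ) :
    (standardSeq d (n + 2)).countP P =
      d n * (standardSeq d (n + 1)).countP P + (standardSeq d n).countP P := by
  simp [standardSeq_add_two, List.countP_flatten]

theorem length_standardSeq_pos (d : ℕ → ℕ) (n : ℕ) : 0 < (standardSeq d n).length := by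
  induction n using Nat.twoStepInduction with
  | zero => simp [standardSeq]
  | one => simp [standardSeq]
  | more n ih _ =>
    rw [length_standardSeq_add_two]
    omega

/-- A 2×2 determinant: the recursion adds a multiple of one row to the other and swaps them, so only
the sign changes. -/
theorem countP_mul_length_standardSeq (d : ℕ → ℕ) (n : ℕ) :
    ((standardSeq d n).countP Letter.isA : ℤ) * (standardSeq d (n + 1)).length -
      (standardSeq d (n + 1)).countP Letter.isA * (standardSeq d n).length = (-1) ^ (n + 1) := by
  induction n with
  | zero => simp [standardSeq, Letter.isA]
  | succ n ih =>
    rw [length_standardSeq_add_two, countP_standardSeq_add_two, pow_succ, ← ih]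
    push_cast
    ring

theorem coprime_countP_length_standardSeq (d : ℕ → ℕ) (n : ℕ) :
    Nat.Coprime ((standardSeq d n).countP Letter.isA) (standardSeq d n).length := by
  rw [← Nat.isCoprime_iff_coprime]
  have h := countP_mul_length_standardSeq d n
  refine ⟨(-1) ^ (n + 1) * (standardSeq d (n + 1)).length,
    -((-1) ^ (n + 1) * (standardSeq d (n + 1)).countP Letter.isA), ?_⟩
  have h2 : ((-1 : ℤ) ^ (n + 1)) * (-1) ^ (n + 1) = 1 := by
    rw [← mul_pow]
    norm_num
  linear_combination (-1) ^ (n + 1) * h + h2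

/-- The two products of consecutive words of the standard sequence differ exactly by a swap of
their last two letters. -/
theorem standardSeq_append_swap (d : ℕ → ℕ) (n : ℕ) : ∃ (c : List Letter) (x y : Letter), x ≠ y ∧
    standardSeq d n ++ standardSeq d (n + 1) = c ++ [x, y] ∧
    standardSeq d (n + 1) ++ standardSeq d n = c ++ [y, x] := by
  induction n with
  | zero => exact ⟨[], .b, .a, by simp, rfl, rfl⟩
  | succ n ih =>
    obtain ⟨c, x, y, hxy, h1, h2⟩ := ih
    have hcomm : standardSeq d (n + 1) ++ (List.replicate (d n) (standardSeq d (n + 1))).flatten =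
        (List.replicate (d n) (standardSeq d (n + 1))).flatten ++ standardSeq d (n + 1) := by
      rw [← List.flatten_cons, ← List.replicate_succ, List.replicate_succ']
      simp
    refine ⟨(List.replicate (d n) (standardSeq d (n + 1))).flatten ++ c, y, x, hxy.symm, ?_, ?_⟩
    · rw [standardSeq_add_two, ← List.append_assoc, hcomm, List.append_assoc, h2,
        List.append_assoc]
    · rw [standardSeq_add_two, List.append_assoc, h1, List.append_assoc]

/-- The bound excludes d_0 = 0, where s_1 = b does not begin with s_0 = a. -/
theorem standardSeq_prefix_succ {n : ℕ} (h : 1 ≤ d n) :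
    standardSeq d (n + 1) <+: standardSeq d (n + 2) := by
  obtain ⟨k, hk⟩ := Nat.exists_eq_add_of_le' h
  rw [standardSeq_add_two, hk, List.replicate_succ, List.flatten_cons, List.append_assoc]
  exact List.prefix_append _ _

theorem standardSeq_append_prefix (hd : ∀ n, 1 ≤ n → 1 ≤ d n) {n : ℕ} (h : 1 ≤ d n) {m : ℕ}
    (hm : n + 3 ≤ m) : standardSeq d (n + 2) ++ standardSeq d (n + 1) <+: standardSeq d m := by
  induction m, hm using Nat.le_induction with
  | base =>
    obtain ⟨k, hk⟩ := Nat.exists_eq_add_of_le' (hd (n + 1) (by omega))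
    rw [standardSeq_add_two d (n + 1), hk, List.replicate_succ, List.flatten_cons,
      List.append_assoc, List.prefix_append_right_inj]
    cases k with
    | zero => simp
    | succ k =>
      rw [List.replicate_succ, List.flatten_cons, List.append_assoc]
      exact (standardSeq_prefix_succ h).trans (List.prefix_append _ _)
  | succ m hm ih =>
    obtain ⟨k, rfl⟩ := Nat.exists_eq_add_of_le' (show 1 ≤ m by omega)
    exact ih.trans (standardSeq_prefix_succ (hd k (by omega)))

/-! ### Periods and closedness of prefixes of w -/

variable {w : ℕ → Letter} (hd : ∀ n, 1 ≤ n → 1 ≤ d n) (hw : ConvergesTo (standardSeq d) w) {n : ℕ}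
  (h : 1 ≤ d n)

include hd hw h

theorem standardSeq_append_getElem? {i : ℕ}
    (hi : i < (standardSeq d (n + 2) ++ standardSeq d (n + 1)).length) :
    (standardSeq d (n + 2) ++ standardSeq d (n + 1))[i]? = some (w i) := by
  obtain ⟨m, h1, h2⟩ := ((hw i).and (Filter.eventually_ge_atTop (n + 3))).exists
  obtain ⟨t, ht⟩ := standardSeq_append_prefix hd h h2
  rw [← h1, ← ht, List.getElem?_append_left hi]

theorem standardSeq_getElem? {i : ℕ} (hi : i < (standardSeq d (n + 1)).length) :
    (standardSeq d (n + 1))[i]? = some (w i) := by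
  obtain ⟨t, ht⟩ := standardSeq_prefix_succ h
  have hlen := congrArg List.length ht
  rw [List.length_append] at hlen
  rw [← standardSeq_append_getElem? hd hw h (i := i) (by rw [List.length_append]; omega), ← ht,
    List.append_assoc, List.getElem?_append_left hi]

/-- The words of the standard sequence are primitive. -/
theorem eq_length_of_hasPrefixPeriod {g : ℕ} (hg : g ∣ (standardSeq d (n + 1)).length)
    (hper : HasPrefixPeriod w g (standardSeq d (n + 1)).length) :
    g = (standardSeq d (n + 1)).length := by
  obtain ⟨k, hk⟩ := hg
  have hc := coprime_countP_length_standardSeq d (n + 1)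
  have e := eq_wordPrefix (fun i hi => standardSeq_getElem? hd hw h (i := i) hi)
  have hcount : (standardSeq d (n + 1)).countP Letter.isA =
      k * Nat.count (fun i => (w i).isA = true) g := by
    rw [e, countP_wordPrefix, hk, mul_comm g k]
    rw [hk, mul_comm] at hper
    exact hper.count_mul (fun x => x.isA = true) k
  -- In a k-th power, k divides both the length and the number of letters a.
  have hk1 : k ∣ 1 := by
    rw [← hc]
    exact Nat.dvd_gcd (hcount ▸ dvd_mul_right _ _) (hk ▸ dvd_mul_left _ _)
  rw [hk, Nat.dvd_one.1 hk1, mul_one]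

theorem hasPrefixPeriod_length_standardSeq : HasPrefixPeriod w (standardSeq d (n + 1)).length
    ((standardSeq d (n + 2)).length + (standardSeq d (n + 1)).length - 2) := by
  obtain ⟨c, x, y, hxy, h1, h2⟩ := standardSeq_append_swap d (n + 1)
  rw [show n + 1 + 1 = n + 2 from rfl] at h1 h2
  have hl := congrArg List.length h2
  simp only [List.length_append, List.length_cons, List.length_nil] at hl
  intro i hi
  have e1 := standardSeq_append_getElem? hd hw h (i := i + (standardSeq d (n + 1)).length)
    (by rw [List.length_append]; omega)
  have e2 := standardSeq_append_getElem? hd hw h (i := i) (by rw [List.length_append]; omega)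
  -- Before the swapped pair the two products agree, so letter i + q_n of w is letter i of s_{n+1}.
  rw [h2, List.getElem?_append_left (by omega),
    ← List.getElem?_append_left (l₂ := [x, y]) (by omega), ← h1,
    List.getElem?_append_right (by omega), Nat.add_sub_cancel] at e1
  rw [List.getElem?_append_left (by omega)] at e2
  exact Option.some_inj.1 (e2.symm.trans e1)

/-- The first swapped letter breaks the period; `h2` keeps the subtraction of 2 from truncating. -/
theorem not_hasPrefixPeriod_length_standardSeq (h2 : 2 ≤ (standardSeq d (n + 2)).length) :
    ¬ HasPrefixPeriod w (standardSeq d (n + 1)).length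
      ((standardSeq d (n + 2)).length + (standardSeq d (n + 1)).length - 1) := by
  intro hper
  obtain ⟨c, x, y, hxy, h3, h4⟩ := standardSeq_append_swap d (n + 1)
  rw [show n + 1 + 1 = n + 2 from rfl] at h3 h4
  have hl := congrArg List.length h4
  simp only [List.length_append, List.length_cons, List.length_nil] at hl
  have e0 := hper ((standardSeq d (n + 2)).length - 2) (by omega)
  have hi : (standardSeq d (n + 2)).length - 2 + (standardSeq d (n + 1)).length = c.length := by
    omega
  have e1 := standardSeq_append_getElem? hd hw h (i := c.length)
    (by rw [List.length_append]; omega)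
  have e2 := standardSeq_append_getElem? hd hw h (i := (standardSeq d (n + 2)).length - 2)
    (by rw [List.length_append]; omega)
  rw [h4] at e1
  have e3 : (standardSeq d (n + 1) ++ standardSeq d (n + 2))[c.length]? =
      some (w ((standardSeq d (n + 2)).length - 2)) := by
    rw [← e2, List.getElem?_append_right (by omega), List.getElem?_append_left (by omega)]
    congr 1
    omega
  rw [h3] at e3
  rw [e0, hi] at e3
  simp at e1 e3
  exact hxy (e3.trans e1.symm)

theorem isClosedWord_of_le {L : ℕ} (h1 : 2 * (standardSeq d (n + 1)).length - 2 < L)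
    (h2 : L ≤ (standardSeq d (n + 2)).length + (standardSeq d (n + 1)).length - 2) :
    IsClosedWord (wordPrefix w L) := by
  have hper := hasPrefixPeriod_length_standardSeq hd hw h
  have hprim := fun g => eq_length_of_hasPrefixPeriod hd hw h (g := g)
  have hq := length_standardSeq_pos d (n + 1)
  generalize (standardSeq d (n + 1)).length = q at *
  rw [isClosedWord_wordPrefix_iff w (by omega)]
  refine ⟨q, hq, by omega, hper.mono h2, fun i hi0 hiq => ?_⟩
  by_contra! hcon
  have hi : HasPrefixPeriod w i (i + (L - q)) := fun j hj => by
    rw [add_comm j i, hcon j (by omega)]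
  have hg0 : 0 < i.gcd q := Nat.gcd_pos_of_pos_left _ hi0
  -- Fine–Wilf needs 2q ≤ L + gcd, which L ≥ 2q - 1 just ensures.
  have hg := hi.gcd (hper.mono (by omega)) (by omega)
  have := hprim _ (Nat.gcd_dvd_right i q) (hg.mono (by omega))
  have := Nat.le_of_dvd hi0 (Nat.gcd_dvd_left i q)
  omega

theorem not_isClosedWord_of_le {L : ℕ}
    (h1 : (standardSeq d (n + 2)).length + (standardSeq d (n + 1)).length - 2 < L)
    (h2 : L ≤ 2 * (standardSeq d (n + 2)).length - 2) :
    ¬ IsClosedWord (wordPrefix w L) := by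
  have hper := hasPrefixPeriod_length_standardSeq hd hw h
  have hnper := not_hasPrefixPeriod_length_standardSeq hd hw h
  have hprim := fun g => eq_length_of_hasPrefixPeriod hd hw h (g := g)
  have hd1 := hd (n + 1) (by omega)
  have hper' := hasPrefixPeriod_length_standardSeq hd hw hd1
  have hlen := length_standardSeq_add_two d (n + 1)
  have hmul := Nat.le_mul_of_pos_left (standardSeq d (n + 2)).length hd1
  rw [show n + 1 + 2 = n + 3 from rfl, show n + 1 + 1 = n + 2 from rfl] at *
  have hq := length_standardSeq_pos d (n + 1)
  generalize (standardSeq d (n + 1)).length = q at *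
  generalize (standardSeq d (n + 2)).length = r at *
  generalize (standardSeq d (n + 3)).length = t at *
  rw [isClosedWord_wordPrefix_iff w (by omega)]
  rintro ⟨p, hp0, hpL, hp, hint⟩
  -- A period p < r would be a multiple of q by Fine–Wilf and primitivity, and q would then be a
  -- period of all L letters.
  have hpr : r ≤ p := by
    by_contra! hlt
    have hg0 : 0 < p.gcd q := Nat.gcd_pos_of_pos_left _ hp0
    have hg := (hp.mono (M := r + q - 2) (by omega)).gcd hper (by omega)
    have heq := hprim _ (Nat.gcd_dvd_right p q) (hg.mono (by omega))
    have hdvd : q ∣ p := heq ▸ Nat.gcd_dvd_left p q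
    exact hnper (by omega) ((hper.extend hp hdvd hq hp0 (by omega)).mono (by omega))
  -- The border recurs internally at shift q if p = r, and at shift r if p > r.
  rcases hpr.eq_or_lt with rfl | hlt
  · obtain ⟨j, hj, hne⟩ := hint q hq (by omega)
    exact hne (by rw [add_comm, ← hper j (by omega)])
  · obtain ⟨j, hj, hne⟩ := hint r (by omega) hlt
    exact hne (by rw [add_comm, ← hper' j (by omega)])

end StandardSeq

/-! ### Continuants, expansions and assembly of the runs -/

/-- The lengths of the words of the standard sequence are continuants. -/
theorem continuantSeq_eq_length (d : ℕ → ℕ) {a : ℕ → ℤ} {m : ℕ} (h0 : a 0 = 1)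
    (h : ∀ i, i + 1 < m → a (i + 1) = d i) :
    continuantSeq a m = (standardSeq d m).length := by
  induction m using Nat.twoStepInduction with
  | zero => rfl
  | one => simp [continuantSeq, h0, standardSeq]
  | more m ih1 ih2 =>
    rw [continuantSeq, h m (by omega), ih1 (fun i hi => h i (by omega)),
      ih2 (fun i hi => h i (by omega)), length_standardSeq_add_two]
    push_cast
    ring

/-- Lowering the last entry by 1 removes one copy of q_n = K[1, d_0, …, d_{n-1}] from q_{n+1}. -/
theorem continuant_eq_length_sub_length (d : ℕ → ℕ) (n : ℕ) :
    continuant ([1] ++ (List.range n).map (fun i => (d i : ℤ)) ++ [(d n : ℤ) - 1]) =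
      (standardSeq d (n + 2)).length - (standardSeq d (n + 1)).length := by
  have hlen : ([1] ++ (List.range n).map (fun i => (d i : ℤ)) ++ [(d n : ℤ) - 1]).length =
      n + 2 := by
    simp
  rw [continuant, hlen, continuantSeq, continuantSeq_eq_length d, continuantSeq_eq_length d,
    length_standardSeq_add_two]
  · have hlast : ([1] ++ (List.range n).map (fun i => (d i : ℤ)) ++ [(d n : ℤ) - 1]).getD (n + 1) 0 =
        (d n : ℤ) - 1 := by
      rw [List.getD_append_right _ _ _ _ (by simp)]
      simp
    rw [hlast]
    push_cast
    ring
  · simp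
  · intro i hi
    simp [List.getElem?_append_left, show i < n by omega]
  · simp
  · intro i hi
    simp [List.getElem?_append_left, show i < n by omega]

theorem HasExpansion.one_le {α : ℝ} {d : ℕ → ℕ} (h : HasExpansion α d) {n : ℕ} (hn : 1 ≤ n) :
    1 ≤ d n := by
  have := GenContFract.of_one_le_get?_partDen (h.2.2 n hn)
  exact_mod_cast this

theorem HasExpansion.unique {α : ℝ} {d e : ℕ → ℕ} (hd : HasExpansion α d)
    (he : HasExpansion α e) : d = e := by
  funext n
  rcases Nat.eq_zero_or_pos n with rfl | hn
  · have := Option.some_inj.1 (hd.2.1.symm.trans he.2.1)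
    exact_mod_cast add_right_cancel this
  · exact_mod_cast Option.some_inj.1 ((hd.2.2 n hn).symm.trans (he.2.2 n hn))

theorem wordPrefix_add {A : Type*} (w : ℕ → A) (m k : ℕ) (x : A)
    (h : ∀ i, m ≤ i → i < m + k → w i = x) :
    wordPrefix w (m + k) = wordPrefix w m ++ List.replicate k x := by
  induction k with
  | zero => simp
  | succ k ih =>
    rw [← add_assoc, wordPrefix_succ, ih (fun i h1 h2 => h i h1 (by omega)),
      h (m + k) (by omega) (by omega), List.replicate_succ', List.append_assoc]

section

variable {d : ℕ → ℕ}

theorem length_standardSeq_le_succ (hd : ∀ n, 1 ≤ n → 1 ≤ d n) (n : ℕ) :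
    (standardSeq d (n + 1)).length ≤ (standardSeq d (n + 2)).length := by
  rw [length_standardSeq_add_two]
  rcases Nat.eq_zero_or_pos n with rfl | hn
  · simp [standardSeq]
  · have := Nat.le_mul_of_pos_left (standardSeq d (n + 1)).length (hd n hn)
    omega

theorem length_standardSeq_lt_succ {n : ℕ} (h : 1 ≤ d n) :
    (standardSeq d (n + 1)).length < (standardSeq d (n + 2)).length := by
  rw [length_standardSeq_add_two]
  have := Nat.le_mul_of_pos_left (standardSeq d (n + 1)).length h
  have := length_standardSeq_pos d n
  omega

/-- Unbounded lengths make the finite products of blocks reach every letter. -/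
theorem le_length_standardSeq (hd : ∀ n, 1 ≤ n → 1 ≤ d n) (n : ℕ) :
    n ≤ (standardSeq d (n + 1)).length := by
  induction n with
  | zero => simp
  | succ n ih =>
    rcases Nat.eq_zero_or_pos n with rfl | hn
    · exact length_standardSeq_pos d _
    · have := length_standardSeq_lt_succ (hd n hn)
      rw [show n + 1 + 1 = n + 2 from rfl]
      omega

/-- The product of the first `N` blocks `1 ^ k 0 ^ k` is a prefix of the oc-sequence. -/
theorem flatten_blocks_eq_wordPrefix_oc (hd : ∀ n, 1 ≤ n → 1 ≤ d n) {w : ℕ → Letter}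
    (hw : ConvergesTo (standardSeq d) w) {k : ℕ → ℕ}
    (hk : ∀ n, (standardSeq d (n + 2)).length = (standardSeq d (n + 1)).length + k n) (N : ℕ) :
    ((List.range N).map (fun n =>
      List.replicate (k n) (1 : Fin 2) ++ List.replicate (k n) (0 : Fin 2))).flatten =
      wordPrefix (oc w) (2 * (standardSeq d (N + 1)).length - 2) := by
  induction N with
  | zero => simp [standardSeq, wordPrefix]
  | succ n ih =>
    rw [List.range_succ, List.map_append, List.flatten_append, ih]
    have hpos := length_standardSeq_pos d (n + 1)
    -- A zero can only be d_0; then q_1 = q_0 = 1 and the block is empty.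
    rcases Nat.eq_zero_or_pos (d n) with h0 | h1
    · have hn : n = 0 := by
        by_contra hn
        have := hd n (by omega)
        omega
      subst hn
      have hk0 : k 0 = 0 := by
        have := hk 0
        rw [length_standardSeq_add_two, h0] at this
        simpa [standardSeq] using this
      have := hk 0
      rw [hk0] at this
      simp [hk0, this]
    · have e : 2 * (standardSeq d (n + 2)).length - 2 =
          2 * (standardSeq d (n + 1)).length - 2 + k n + k n := by
        rw [hk]
        omega
      have hkn := hk n
      rw [e, wordPrefix_add _ _ _ 0, wordPrefix_add _ _ _ 1]
      · simp
      · intro i hi1 hi2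
        exact if_pos (isClosedWord_of_le hd hw h1 (by omega) (by omega))
      · intro i hi1 hi2
        exact if_neg (not_isClosedWord_of_le hd hw h1 (by omega) (by omega))

end

end OCSeq

theorem mainTheorem4 (α : ℝ) (d : ℕ → ℕ) (hd : OCSeq.HasExpansion α d)
    (w : ℕ → OCSeq.Letter) (hw : OCSeq.IsStandardSturmianOfSlope w α) :
    ∃ k : ℕ → ℕ,
      (∀ n, (k n : ℤ) =
        OCSeq.continuant ([1] ++ (List.range n).map (fun i => (d i : ℤ)) ++ [(d n : ℤ) - 1])) ∧
      (0 < d 0 → 0 < k 0) ∧ (∀ n, 1 ≤ n → 0 < k n) ∧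
      OCSeq.IsInfiniteProduct
        (fun n => List.replicate (k n) (1 : Fin 2) ++ List.replicate (k n) (0 : Fin 2))
        (OCSeq.oc w) := by
  obtain ⟨-, -, -, e, he, hconv⟩ := hw
  obtain rfl := hd.unique he
  have h1 : ∀ n, 1 ≤ n → 1 ≤ d n := fun n hn => hd.one_le hn
  have hle := OCSeq.length_standardSeq_le_succ h1
  refine ⟨fun n => (OCSeq.standardSeq d (n + 2)).length - (OCSeq.standardSeq d (n + 1)).length,
    fun n => ?_, fun h => ?_, fun n hn => ?_, fun i => ?_⟩
  · rw [OCSeq.continuant_eq_length_sub_length, Nat.cast_sub (hle n)]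
  · exact Nat.sub_pos_of_lt (OCSeq.length_standardSeq_lt_succ h)
  · exact Nat.sub_pos_of_lt (OCSeq.length_standardSeq_lt_succ (h1 n hn))
  · filter_upwards [Filter.eventually_ge_atTop (i + 2)] with N hN
    have := OCSeq.le_length_standardSeq h1 N
    rw [OCSeq.flatten_blocks_eq_wordPrefix_oc h1 hconv
      (fun n => (Nat.add_sub_of_le (hle n)).symm)]
    simp [OCSeq.wordPrefix, show i < 2 * (OCSeq.standardSeq d (N + 1)).length - 2 by omega]
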